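/- Let $\mathbb T=\{z\in\mathbb C:|z|=1\}$ be the circle group. For an abelian topological group $A$, a character of $A$ is a continuous homomorphism $\chi:A\to\mathbb T$, and $(\chi,a)$ denotes its value at $a$; the group of characters is denoted by $A^{\wedge}$. A subgroup $H$ of $A$ is called dually closed if for every $a\in A\setminus H$ there is a character $\chi$ of $A$ with $(\chi,h)=1$ for all $h\in H$ and $(\chi,a)\neq 1$. For a compact metrizable abelian group $X$ and a sequence $\mathbf u=\{u_n\}$ in $X^{\wedge}$ put $s_{\mathbf u}(X)=\{x\in X:(u_n,x)\to 1\}$; a subgroup $G$ of $X$ is characterized by $\mathbf u$ in $X$ if $G=s_{\mathbf u}(X)$, and it is characterized in $X$ if this holds for some sequence $\mathbf u$ in $X^{\wedge}$. Let $\mathbb T_0^H=\{(z_n)\in\mathbb T^{\mathbb N}: z_n\to 1\}$, with coordinatewise multiplication and the metric $d_0((z_n),(w_n))=\sup_n|z_n-w_n|$. Let $G$ be a subgroup of an infinite compact metrizable abelian group $X$. 1. Let $G$ be dense in $X$ and let $\mathbf u=\{u_n\}$ be a sequence in $X^{\wedge}$. Then $G$ is characterized by $\mathbf u$ if and only if there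 exists a dually closed subgroup $G_{\mathbf u}$ of $X\times\mathbb T_0^H$ such that the projection $(x,\omega)\mapsto x$ restricts to a bijection of $G_{\mathbf u}$ onto $G$ and, for every $n$, $$(u_n,g)=z_n\qquad\text{for all }(g,\omega)\in G_{\mathbf u},\ \omega=(z_k).$$ 2. $G$ is characterized in $X$ if and only if it is characterized in its closure $\mathrm{Cl}_X(G)$. -/

import Mathlib

open Filter Topology

/-- `s_u(X)`: the subgroup of all `x` in `X` such that `(u_n, x) → 1`. -/
def sSubgroup {X : Type*} [CommGroup X] [TopologicalSpace X]
    (u : ℕ → PontryaginDual X) : Subgroup X where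
  carrier := {x | Tendsto (fun n => u n x) atTop (𝓝 1)}
  one_mem' := by simp
  mul_mem' := by
    intro a b ha hb
    simpa using Tendsto.mul ha hb
  inv_mem' := by
    intro a ha
    simpa using Tendsto.inv ha

/-- `G` is characterized by the sequence of characters `u` if `G = s_u(X)`. -/
def CharacterizedBy {X : Type*} [CommGroup X] [TopologicalSpace X]
    (G : Subgroup X) (u : ℕ → PontryaginDual X) : Prop :=
  G = sSubgroup u

/-- `G` is a characterized subgroup of `X` if some sequence of characters of `X`
characterizes it. -/
def IsCharacterized {X : Type*} [CommGroup X] [TopologicalSpace X]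
    (G : Subgroup X) : Prop :=
  ∃ u : ℕ → PontryaginDual X, CharacterizedBy G u

/-- A subgroup `H` of an abelian topological group `A` is dually closed if every point outside
`H` is separated from `H` by a continuous character of `A` that is trivial on `H`. -/
def DuallyClosed {A : Type*} [CommGroup A] [TopologicalSpace A] (H : Subgroup A) : Prop :=
  ∀ a : A, a ∉ H → ∃ χ : PontryaginDual A, (∀ h ∈ H, χ h = 1) ∧ χ a ≠ 1

/-- The group of all sequences in the circle group that converge to `1`. -/
def nullSeq : Subgroup (ℕ → Circle) where
  carrier := {z | Tendsto z atTop (𝓝 1)}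
  one_mem' := tendsto_const_nhds
  mul_mem' := by
    intro a b ha hb
    have h := Tendsto.mul ha hb
    rw [mul_one] at h
    exact h
  inv_mem' := by
    intro a ha
    have h := Tendsto.inv ha
    rw [inv_one] at h
    exact h

/-- The group `𝕋₀ᴴ`: sequences in the circle converging to `1`. It is a type of its own, so that it
carries the supremum metric and not the product topology. -/
def T0H : Type := nullSeq

namespace T0H

noncomputable instance : CommGroup T0H := inferInstanceAs (CommGroup nullSeq)

/-- The `n`-th coordinate of an element of `𝕋₀ᴴ`. -/
def coord (n : ℕ) (w : T0H) : Circle := w.1 n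

theorem ext_coord {v w : T0H} (h : ∀ n, coord n v = coord n w) : v = w :=
  Subtype.ext (funext h)

theorem bddAbove_dist (v w : T0H) :
    BddAbove (Set.range fun n => dist (coord n v) (coord n w)) := by
  refine ⟨Metric.diam (Set.univ : Set Circle), ?_⟩
  rintro _ ⟨n, rfl⟩
  exact Metric.dist_le_diam_of_mem isCompact_univ.isBounded (Set.mem_univ _) (Set.mem_univ _)

/-- The metric `d₀(v, w) = sup_n |v_n - w_n|`. -/
noncomputable instance : MetricSpace T0H where
  dist v w := ⨆ n, dist (coord n v) (coord n w)
  dist_self v := by simp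
  dist_comm v w := by simp only [dist_comm]
  dist_triangle u v w := ciSup_le fun n =>
    (dist_triangle (coord n u) (coord n v) (coord n w)).trans
      (add_le_add (le_ciSup (bddAbove_dist u v) n) (le_ciSup (bddAbove_dist v w) n))
  eq_of_dist_eq_zero := by
    intro v w h
    refine ext_coord fun n => dist_le_zero.1 ?_
    rw [← h]
    exact le_ciSup (bddAbove_dist v w) n

end T0H

/-! For part 1 the only candidate for the dually closed group is the graph of `x ↦ (u n x)` over
`sSubgroup u`. It is dually closed, being cut out by characters. Conversely, an admissible `Gu` lies
in this graph. Every character of `T0H` is a monomial in finitely many coordinates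
(`T0H.exists_character_eq_prod`), so on the graph a character of the product is a continuous
function of `x` alone. If it is trivial on `Gu`, that function is `1` on the dense `G`, hence
everywhere, so dual closedness leaves no room between `Gu` and the graph.

For part 2, restriction gives one direction. For the other, extend the characters from the closure
and interleave them with countably many characters cutting out the closure, each repeated infinitely
often. The duality this needs comes from Haar measure: compact operators give enough characters, and
Stone–Weierstrass shows that a point-separating group of them is everything. -/

open MeasureTheory

/-! ### Joint eigenvectors of unitary representations -/

/-- A commuting family of endomorphisms has a joint eigenvector in every nonzero
finite-dimensional invariant subspace. -/
theorem exists_joint_eigenvector {ι V : Type*} [AddCommGroup V] [Module ℂ V]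
    (f : ι → Module.End ℂ V) (hf : ∀ i j v, f i (f j v) = f j (f i v))
    (E : Submodule ℂ V) [FiniteDimensional ℂ E] (hE : E ≠ ⊥)
    (hinv : ∀ i, ∀ v ∈ E, f i v ∈ E) :
    ∃ v ∈ E, v ≠ 0 ∧ ∀ i, ∃ c : ℂ, f i v = c • v := by
  induction hn : Module.finrank ℂ E using Nat.strong_induction_on generalizing E with
  | _ n ih =>
    -- If some `f i` is not scalar on `E`, its eigenspace in `E` is proper and, by commutation,
    -- invariant, so the dimension drops.
    by_cases hs : ∀ i, ∃ c : ℂ, ∀ v ∈ E, f i v = c • v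
    · obtain ⟨v, hv, hv0⟩ := E.exists_mem_ne_zero_of_ne_bot hE
      exact ⟨v, hv, hv0, fun i => (hs i).imp fun c hc => hc v hv⟩
    · push Not at hs
      obtain ⟨i, hi⟩ := hs
      have : Nontrivial E := Submodule.nontrivial_iff_ne_bot.2 hE
      obtain ⟨c, hc⟩ := Module.End.exists_eigenvalue ((f i).restrict (hinv i))
      obtain ⟨w, hw, hw0⟩ := hc.exists_hasEigenvector
      rw [Module.End.mem_eigenspace_iff] at hw
      have hw' : f i w = c • (w : V) := congrArg Subtype.val hw
      have hle : E ⊓ Module.End.eigenspace (f i) c ≤ E := inf_le_left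
      have : FiniteDimensional ℂ (E ⊓ Module.End.eigenspace (f i) c : Submodule ℂ V) :=
        Submodule.finiteDimensional_of_le hle
      obtain ⟨u, hu, hne⟩ := hi c
      have hlt : E ⊓ Module.End.eigenspace (f i) c < E :=
        lt_of_le_of_ne hle fun h => hne
          (Module.End.mem_eigenspace_iff.1 (inf_eq_left.1 h hu))
      obtain ⟨v, hv, hv0, hvc⟩ := ih _ (hn ▸ Submodule.finrank_lt_finrank_of_lt hlt)
        (E ⊓ Module.End.eigenspace (f i) c)
        (fun h => hw0 (Subtype.ext ((Submodule.eq_bot_iff _).1 h w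
          ⟨w.2, Module.End.mem_eigenspace_iff.2 hw'⟩)))
        (fun j v hv => ⟨hinv j v hv.1, by
          refine Module.End.mem_eigenspace_iff.2 ?_
          rw [hf, Module.End.mem_eigenspace_iff.1 hv.2, map_smul]⟩)
        rfl
      exact ⟨v, hv.1, hv0, hvc⟩

theorem inner_map_map_of_norm {G V : Type*} [CommGroup G] [NormedAddCommGroup V]
    [InnerProductSpace ℂ V] (U : G →* (V →L[ℂ] V)) (hU : ∀ x v, ‖U x v‖ = ‖v‖) (x : G)
    (v w : V) : inner ℂ (U x v) (U x w) = inner ℂ v w :=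
  LinearIsometry.inner_map_map (⟨(U x : V →ₗ[ℂ] V), hU x⟩ : V →ₗᵢ[ℂ] V) v w

section UnitaryRepresentation

variable {G V : Type*} [CommGroup G] [TopologicalSpace G] [IsTopologicalGroup G] [CompactSpace G]
  [MeasurableSpace G] [BorelSpace G]
  [NormedAddCommGroup V] [InnerProductSpace ℂ V] [CompleteSpace V]

/-- The average of the rank one operators `v ↦ ⟪U x h, v⟫ • U x h` over a compact group is a
compact self-adjoint operator commuting with the representation. -/
theorem exists_average_rank_one (μ : Measure G) [IsProbabilityMeasure μ] [μ.IsMulLeftInvariant]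
    [μ.IsOpenPosMeasure]
    (U : G →* (V →L[ℂ] V)) (hU : ∀ x v, ‖U x v‖ = ‖v‖) (hc : ∀ v, Continuous fun x => U x v)
    {h : V} (h0 : h ≠ 0) :
    ∃ S : V →L[ℂ] V, IsCompactOperator S ∧ S.IsSymmetric ∧ S ≠ 0 ∧
      (∀ y v, S (U y v) = U y (S v)) ∧
      ∀ v, (∀ x, inner ℂ (U x h) v = 0) → S v = 0 := by
  have hcont (v : V) : Continuous fun x => inner ℂ (U x h) v • U x h :=
    ((hc h).inner continuous_const).smul (hc h)
  have hint (v : V) : Integrable (fun x => inner ℂ (U x h) v • U x h) μ :=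
    (hcont v).integrable_of_hasCompactSupport (HasCompactSupport.of_compactSpace _)
  let S₀ : V →ₗ[ℂ] V :=
    { toFun := fun v => ∫ x, inner ℂ (U x h) v • U x h ∂μ
      map_add' := fun v w => by
        rw [← integral_add (hint v) (hint w)]
        simp only [inner_add_right, add_smul]
      map_smul' := fun c v => by
        rw [RingHom.id_apply, ← integral_smul]
        simp only [inner_smul_right, mul_smul] }
  have hbound (v : V) : ‖S₀ v‖ ≤ ‖h‖ ^ 2 * ‖v‖ := by
    refine (norm_integral_le_of_norm_le_const (C := ‖h‖ ^ 2 * ‖v‖)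
      (Eventually.of_forall fun x => ?_)).trans (by simp)
    rw [norm_smul, hU]
    have := norm_inner_le_norm (𝕜 := ℂ) (U x h) v
    rw [hU] at this
    nlinarith [norm_nonneg h]
  let S : V →L[ℂ] V := S₀.mkContinuous _ hbound
  have hS (v : V) : S v = ∫ x, inner ℂ (U x h) v • U x h ∂μ := rfl
  have hinner (v w : V) : inner ℂ w (S v) = ∫ x, inner ℂ (U x h) v * inner ℂ w (U x h) ∂μ := by
    rw [hS, ← integral_inner (hint v)]
    simp only [inner_smul_right]
  refine ⟨S, ?_, ?_, ?_, ?_, ?_⟩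
  · rw [show (S : V → V) = S₀ from rfl,
      isCompactOperator_iff_image_closedBall_subset_compact S₀ one_pos]
    -- The image of the unit ball consists of averages of points of a disc times an orbit, hence
    -- lies in the closed convex hull of a compact set.
    let K : Set V := (fun p : ℂ × G => p.1 • U p.2 h) '' (Metric.closedBall 0 ‖h‖ ×ˢ Set.univ)
    have hK : IsCompact K := ((isCompact_closedBall _ _).prod isCompact_univ).image
      (continuous_fst.smul ((hc h).comp continuous_snd))
    refine ⟨closure (convexHull ℝ K), ?_, ?_⟩
    · exact hK.totallyBounded.convexHull.closure.isCompact_of_isClosed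
        isClosed_closure
    · rintro _ ⟨v, hv, rfl⟩
      refine (convex_convexHull ℝ K).closure.integral_mem isClosed_closure
        (Eventually.of_forall fun x => subset_closure (subset_convexHull ℝ K ?_)) (hint v)
      refine ⟨(inner ℂ (U x h) v, x), ⟨?_, trivial⟩, rfl⟩
      rw [mem_closedBall_zero_iff] at hv ⊢
      have := norm_inner_le_norm (𝕜 := ℂ) (U x h) v
      rw [hU] at this
      exact this.trans (mul_le_of_le_one_right (norm_nonneg h) hv)
  · intro v w
    change inner ℂ (S v) w = inner ℂ v (S w)
    rw [← inner_conj_symm, hinner, hinner, ← integral_conj]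
    refine integral_congr_ae (Eventually.of_forall fun x => ?_)
    simp only [map_mul, inner_conj_symm]
    ring
  · intro h1
    -- This integral is `⟪h, S h⟫`; its continuous integrand is positive at `x = 1`, so it cannot
    -- vanish.
    have h2 : ∫ x, ‖(inner ℂ (U x h) h : ℂ)‖ ^ 2 ∂μ = 0 := by
      have := hinner h h
      rw [h1] at this
      simp only [zero_apply, inner_zero_right] at this
      have e : ∀ x, inner ℂ (U x h) h * inner ℂ h (U x h) =
          ((‖(inner ℂ (U x h) h : ℂ)‖ ^ 2 : ℝ) : ℂ) := fun x => by
        rw [← inner_conj_symm h (U x h), Complex.mul_conj, Complex.normSq_eq_norm_sq]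
      simp only [e, integral_complex_ofReal] at this
      exact_mod_cast this.symm
    have h3 : Continuous fun x => ‖(inner ℂ (U x h) h : ℂ)‖ ^ 2 :=
      (((hc h).inner continuous_const).norm).pow 2
    have h4 := (h3.integral_pos_of_hasCompactSupport_nonneg_nonzero (μ := μ) (x := 1)
      (HasCompactSupport.of_compactSpace _) (fun x => by positivity)
      (by simp [h0]))
    exact h4.ne' h2
  · intro y v
    rw [hS, hS, ← ContinuousLinearMap.integral_comp_comm _ (hint v),
      ← integral_mul_left_eq_self _ y]
    refine integral_congr_ae (Eventually.of_forall fun x => ?_)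
    simp only [map_mul, map_smul, mul_apply_eq_comp]
    rw [inner_map_map_of_norm U hU]
  · intro v hv
    simp [hS, hv]

/-- A unitary representation of a compact abelian group has, for every `h ≠ 0`, a joint eigenvector
not orthogonal to `h`; its eigenvalues form a character. -/
theorem exists_character_eigenvector (μ : Measure G) [IsProbabilityMeasure μ]
    [μ.IsMulLeftInvariant] [μ.IsOpenPosMeasure]
    (U : G →* (V →L[ℂ] V)) (hU : ∀ x v, ‖U x v‖ = ‖v‖) (hc : ∀ v, Continuous fun x => U x v)
    {h : V} (h0 : h ≠ 0) :
    ∃ (χ : PontryaginDual G) (v : V), (∀ x, U x v = (χ x : ℂ) • v) ∧ inner ℂ h v ≠ 0 := by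
  obtain ⟨S, hcomp, hsymm, hS0, hcomm, hker⟩ := exists_average_rank_one μ U hU hc h0
  have := mt (ContinuousLinearMap.eq_zero_of_forall_hasEigenvalue_eq_zero hcomp hsymm).1 hS0
  push Not at this
  obtain ⟨l, hl, hl0⟩ := this
  have hfin := ContinuousLinearMap.finite_dimensional_eigenspace hcomp l hl0
  obtain ⟨v, hv, hv0, hvc⟩ := exists_joint_eigenvector (fun x => (U x : V →ₗ[ℂ] V))
    (fun x y v => by
      change U x (U y v) = U y (U x v)
      rw [← mul_apply_eq_comp, ← map_mul, mul_comm, map_mul]; rfl)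
    _ hl (fun x v hv => by
      rw [Module.End.mem_eigenspace_iff] at hv ⊢
      change S (U x v) = l • U x v
      rw [hcomm, show S v = l • v from hv, map_smul])
  choose c hc' using hvc
  replace hc' : ∀ x, U x v = c x • v := hc'
  have hnorm (x : G) : ‖c x‖ = 1 := by
    have := hU x v
    rw [hc', norm_smul] at this
    exact mul_right_cancel₀ (norm_ne_zero_iff.2 hv0) (this.trans (one_mul _).symm)
  have hinj {a b : ℂ} (hab : a • v = b • v) : a = b := smul_left_injective ℂ hv0 hab
  have hcc : Continuous c := by
    have : c = fun x => inner ℂ v (U x v) / inner ℂ v v := by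
      ext x
      rw [hc', inner_smul_right, mul_div_cancel_right₀ _ (inner_self_ne_zero.2 hv0)]
    rw [this]
    exact (continuous_const.inner (hc v)).div_const _
  let χ : G →ₜ* Circle :=
    { toFun := fun x => ⟨c x, mem_sphere_zero_iff_norm.2 (hnorm x)⟩
      map_one' := Circle.ext (hinj (by rw [← hc']; simp))
      map_mul' := fun x y => Circle.ext (hinj (by
        rw [← hc', map_mul, mul_apply_eq_comp, hc' y, map_smul, hc' x, smul_smul,
          mul_comm]; rfl))
      continuous_toFun := hcc.subtype_mk _ }
  refine ⟨χ, v, hc', fun hhv => ?_⟩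
  -- Orthogonality to `h` spreads to the whole orbit of `h`, because `v` is an eigenvector of every
  -- `U x`; this contradicts `S v = l • v` with `l ≠ 0`.
  have hSv : S v = 0 := hker v fun x => by
    have h1 : inner ℂ (U x h) (U x v) = 0 := (inner_map_map_of_norm U hU x h v).trans hhv
    rw [hc', inner_smul_right] at h1
    refine (mul_eq_zero.1 h1).resolve_left fun h2 => ?_
    simpa [h2] using hnorm x
  have : l • v = 0 := by rw [← show S v = l • v from Module.End.mem_eigenspace_iff.1 hv, hSv]
  exact (smul_ne_zero hl0 hv0) this

end UnitaryRepresentation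

/-! ### Duality for compact abelian groups -/

/-- The characters of a compact abelian group separate points. -/
theorem exists_character_ne_one {G : Type*} [CommGroup G] [TopologicalSpace G]
    [IsTopologicalGroup G] [CompactSpace G] [T2Space G] {a : G} (ha : a ≠ 1) :
    ∃ χ : PontryaginDual G, χ a ≠ 1 := by
  let _ : MeasurableSpace G := borel G
  have : BorelSpace G := ⟨rfl⟩
  let μ : Measure G := Measure.haarMeasure ⊤
  have : IsProbabilityMeasure μ := ⟨by
    simpa using Measure.haarMeasure_self (G := G) (K₀ := ⊤)⟩
  let U : G →* (Lp ℂ 2 μ →L[ℂ] Lp ℂ 2 μ) :=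
    { toFun := fun x => (Lp.compMeasurePreservingₗᵢ ℂ (x • ·)
        (measurePreserving_smul x μ)).toContinuousLinearMap
      map_one' := by
        ext1 f
        exact one_smul (DomMulAct G) f
      map_mul' := fun x y => by
        ext1 f
        rw [mul_comm]
        exact mul_smul (DomMulAct.mk x) (DomMulAct.mk y) f }
  have hUs (x : G) (f : Lp ℂ 2 μ) : U x f = DomMulAct.mk x • f := rfl
  have : Fact ((2 : ENNReal) ≠ ⊤) := ⟨ENNReal.ofNat_ne_top⟩
  obtain ⟨f, hf⟩ : ∃ f : C(G, ℂ), f a ≠ f 1 := by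
    obtain ⟨f, h0, h1, -⟩ := exists_continuous_zero_one_of_isClosed
      (isClosed_singleton (x := a)) (isClosed_singleton (x := (1 : G)))
      (Set.disjoint_singleton.2 ha)
    refine ⟨(ContinuousMap.mk _ Complex.continuous_ofReal).comp f, ?_⟩
    simp [h0 rfl, h1 rfl]
  let F : Lp ℂ 2 μ := ContinuousMap.toLp 2 μ ℂ f
  -- In the regular representation, an eigenvector whose character is `1` at `a` is fixed by `U a`,
  -- hence orthogonal to `F - U a F`.
  have hF : F - U a F ≠ 0 := by
    intro h
    have h1 : U a F = ContinuousMap.toLp 2 μ ℂ (f.comp ⟨(a * ·), continuous_const_mul a⟩) := rfl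
    rw [sub_eq_zero, h1] at h
    have h2 := ContinuousMap.toLp_injective μ h
    have h3 := DFunLike.congr_fun h2 1
    exact hf (by simpa using h3.symm)
  obtain ⟨χ, v, hv, hne⟩ := exists_character_eigenvector μ U
    (fun x f => LinearIsometry.norm_map _ f)
    (fun f => by
      simp only [hUs]
      exact (continuous_smul.comp (DomMulAct.continuous_mk.prodMk continuous_const)))
    hF
  refine ⟨χ, fun h => hne ?_⟩
  have hav : U a v = v := by rw [hv, h]; simp
  rw [inner_sub_left, sub_eq_zero]
  nth_rw 2 [← hav]
  exact (inner_map_map_of_norm U (fun x f => LinearIsometry.norm_map _ f) a F v).symm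

/-- A character of a compact group, as a complex-valued continuous function. -/
noncomputable def PontryaginDual.toContinuousMap {G : Type*} [Monoid G] [TopologicalSpace G] :
    PontryaginDual G →* C(G, ℂ) where
  toFun χ := ⟨fun x => χ x, continuous_subtype_val.comp (map_continuous χ)⟩
  map_one' := by ext; simp
  map_mul' χ ψ := by ext x; exact Circle.coe_mul (χ x) (ψ x)

/-- A subgroup of characters of a compact abelian group that separates points contains every
character. -/
theorem mem_of_separatesPoints {G : Type*} [CommGroup G] [TopologicalSpace G]
    [IsTopologicalGroup G] [CompactSpace G] [T2Space G] (S : Subgroup (PontryaginDual G))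
    (hS : ∀ a b : G, a ≠ b → ∃ χ ∈ S, χ a ≠ χ b) (χ : PontryaginDual G) : χ ∈ S := by
  by_contra hχ
  let _ : MeasurableSpace G := borel G
  have : BorelSpace G := ⟨rfl⟩
  let μ : Measure G := Measure.haarMeasure ⊤
  have : IsProbabilityMeasure μ := ⟨by
    simpa using Measure.haarMeasure_self (G := G) (K₀ := ⊤)⟩
  let e := PontryaginDual.toContinuousMap (G := G)
  have he (ψ : PontryaginDual G) (x : G) : e ψ x = (ψ x : ℂ) := rfl
  -- If `χ ∉ S`, pairing with `χ` kills `S`, hence its dense span, yet gives `1` on `χ` itself.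
  let I : C(G, ℂ) → ℂ := fun f => inner ℂ (ContinuousMap.toLp 2 μ ℂ (e χ))
    (ContinuousMap.toLp 2 μ ℂ f)
  have hI : Continuous I := continuous_const.inner (ContinuousMap.toLp 2 μ ℂ).continuous
  have hIe (ψ : PontryaginDual G) : I (e ψ) = ∫ x, ((ψ * χ⁻¹) x : ℂ) ∂μ := by
    rw [show I (e ψ) = _ from ContinuousMap.inner_toLp μ _ _]
    refine integral_congr_ae (Eventually.of_forall fun x => ?_)
    change (ψ x : ℂ) * (starRingEnd ℂ) (χ x : ℂ) = ((ψ x * (χ x)⁻¹ : Circle) : ℂ)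
    rw [Circle.coe_mul, Circle.coe_inv_eq_conj]
  have horth (ψ : PontryaginDual G) (hψ : ψ ∈ S) : I (e ψ) = 0 := by
    obtain ⟨a, ha⟩ : ∃ a, (ψ * χ⁻¹) a ≠ 1 := by
      by_contra! h
      exact hχ ((mul_inv_eq_one.1 (PontryaginDual.ext h)) ▸ hψ)
    rw [hIe]
    -- Translating by `a` multiplies the integral by a value different from `1`, so the integral is
    -- zero.
    have h1 := integral_mul_left_eq_self (μ := μ) (fun x => ((ψ * χ⁻¹) x : ℂ)) a
    simp only [map_mul, Circle.coe_mul] at h1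
    rw [integral_const_mul] at h1
    by_contra h0
    exact ha (Circle.ext (by simpa using mul_right_cancel₀ h0 (h1.trans (one_mul _).symm)))
  have hstar (ψ : PontryaginDual G) : star (e ψ) = e ψ⁻¹ := by
    ext x
    change (starRingEnd ℂ) (ψ x : ℂ) = (((ψ x)⁻¹ : Circle) : ℂ)
    rw [Circle.coe_inv_eq_conj]
  let M : Submonoid C(G, ℂ) := S.toSubmonoid.map e
  have hM : (M : Set C(G, ℂ)) ∪ star (M : Set C(G, ℂ)) = M := by
    refine Set.union_eq_left.2 fun f hf => ?_
    obtain ⟨ψ, hψ, h⟩ := hf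
    exact ⟨ψ⁻¹, S.inv_mem hψ, by rw [← hstar, h, star_star]⟩
  have hA (f : C(G, ℂ)) (hf : f ∈ StarAlgebra.adjoin ℂ (M : Set C(G, ℂ))) : I f = 0 := by
    rw [← StarSubalgebra.mem_toSubalgebra, StarAlgebra.adjoin_toSubalgebra, hM,
      ← Subalgebra.mem_toSubmodule, Algebra.adjoin_eq_span, Submonoid.closure_eq] at hf
    induction hf using Submodule.span_induction with
    | mem f hf => obtain ⟨ψ, hψ, rfl⟩ := hf; exact horth ψ hψ
    | zero => simp [I]
    | add f g _ _ hf hg => simp only [I, map_add, inner_add_right] at hf hg ⊢; rw [hf, hg, add_zero]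
    | smul c f _ hf => simp only [I, map_smul, inner_smul_right] at hf ⊢; rw [hf, mul_zero]
  have htop := ContinuousMap.starSubalgebra_topologicalClosure_eq_top_of_separatesPoints
    (StarAlgebra.adjoin ℂ (M : Set C(G, ℂ))) (fun a b hab => by
      obtain ⟨ψ, hψ, hne⟩ := hS a b hab
      exact ⟨e ψ, ⟨e ψ, StarAlgebra.subset_adjoin ℂ _ ⟨ψ, hψ, rfl⟩, rfl⟩,
        fun h => hne (Circle.ext h)⟩)
  have hcl : e χ ∈ closure (StarAlgebra.adjoin ℂ (M : Set C(G, ℂ)) : Set C(G, ℂ)) := by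
    rw [← StarSubalgebra.topologicalClosure_coe, htop]; trivial
  have h0 : I (e χ) = 0 := closure_minimal hA (isClosed_eq hI continuous_const) hcl
  rw [hIe, mul_inv_cancel] at h0
  simp at h0

/-- Characters of a closed subgroup of a compact abelian group extend to the group. -/
theorem exists_character_extension {X : Type*} [CommGroup X] [TopologicalSpace X]
    [IsTopologicalGroup X] [CompactSpace X] [T2Space X] (H : Subgroup X)
    (hH : IsClosed (H : Set X)) (χ : PontryaginDual H) :
    ∃ ψ : PontryaginDual X, ∀ x : H, ψ x = χ x := by
  have : CompactSpace H := isCompact_iff_compactSpace.1 hH.isCompact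
  let i : H →ₜ* X := ⟨H.subtype, continuous_subtype_val⟩
  -- The restrictions of characters of `X` form a point-separating subgroup of the dual of `H`,
  -- hence exhaust it.
  obtain ⟨ψ, hψ⟩ := mem_of_separatesPoints (PontryaginDual.map i : PontryaginDual X →* _).range
    (fun a b hab => by
      have : (a : X) * (b : X)⁻¹ ≠ 1 := fun h => hab (Subtype.ext (mul_inv_eq_one.1 h))
      obtain ⟨ψ, hψ⟩ := exists_character_ne_one this
      refine ⟨PontryaginDual.map i ψ, ⟨ψ, rfl⟩, fun h => hψ ?_⟩
      rw [map_mul, map_inv, mul_inv_eq_one]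
      exact h) χ
  exact ⟨ψ, fun x => DFunLike.congr_fun hψ x⟩

/-- Every continuous character of the circle group is a power map. -/
theorem exists_zpow_of_character_circle (χ : PontryaginDual Circle) :
    ∃ m : ℤ, ∀ z : Circle, χ z = z ^ m := by
  let i : PontryaginDual Circle := ContinuousMonoidHom.id Circle
  obtain ⟨m, hm⟩ := Subgroup.mem_zpowers_iff.1 (mem_of_separatesPoints (Subgroup.zpowers i)
    (fun a b hab => ⟨i, Subgroup.mem_zpowers i, hab⟩) χ)
  have hz (z : Circle) (n : ℤ) : (i ^ n) z = z ^ n :=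
    map_zpow (⟨⟨fun φ => φ z, rfl⟩, fun _ _ => rfl⟩ : PontryaginDual Circle →* Circle) i n
  exact ⟨m, fun z => by rw [← hm, hz]⟩

/-- A closed subgroup of a compact abelian group is the intersection of kernels of characters. -/
theorem exists_character_of_notMem {X : Type*} [CommGroup X] [TopologicalSpace X]
    [IsTopologicalGroup X] [CompactSpace X] (H : Subgroup X)
    (hH : IsClosed (H : Set X)) {a : X} (ha : a ∉ H) :
    ∃ ψ : PontryaginDual X, (∀ x ∈ H, ψ x = 1) ∧ ψ a ≠ 1 := by
  have : IsClosed (H : Set X) := hH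
  obtain ⟨χ, hχ⟩ := exists_character_ne_one (G := X ⧸ H) (a := (a : X ⧸ H))
    (by rwa [Ne, QuotientGroup.eq_one_iff])
  let q : X →ₜ* X ⧸ H := ⟨QuotientGroup.mk' H, QuotientGroup.continuous_mk⟩
  refine ⟨PontryaginDual.map q χ, fun x hx => ?_, hχ⟩
  change χ (x : X ⧸ H) = 1
  rw [(QuotientGroup.eq_one_iff x).2 hx, map_one]

/-- In a compact metrizable abelian group, countably many characters cut out a closed subgroup. -/
theorem exists_seq_character_eq_closed {X : Type*} [CommGroup X] [TopologicalSpace X]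
    [IsTopologicalGroup X] [CompactSpace X] [SecondCountableTopology X] (H : Subgroup X)
    (hH : IsClosed (H : Set X)) :
    ∃ w : ℕ → PontryaginDual X, ∀ x, x ∈ H ↔ ∀ n, w n x = 1 := by
  let A := {ψ : PontryaginDual X // ∀ x ∈ H, ψ x = 1}
  -- Lindelöf: the open sets `ψ ≠ 1` cover the complement of `H`, and countably many suffice. The
  -- trivial character is added below so that the family is nonempty and can be enumerated.
  obtain ⟨T, hT, hU⟩ := TopologicalSpace.isOpen_iUnion_countable
    (fun ψ : A => {x : X | ψ.1 x ≠ 1})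
    fun ψ => isOpen_ne_fun (map_continuous ψ.1) continuous_const
  let one : A := ⟨1, fun _ _ => rfl⟩
  obtain ⟨w, hw⟩ := (hT.insert one).exists_eq_range (Set.insert_nonempty _ _)
  refine ⟨fun n => (w n).1, fun x => ⟨fun hx n => (w n).2 x hx, fun h => ?_⟩⟩
  by_contra hx
  obtain ⟨ψ, hψ, hne⟩ := exists_character_of_notMem H hH hx
  have hmem : x ∈ ⋃ ψ : A, {x : X | ψ.1 x ≠ 1} := Set.mem_iUnion.2 ⟨⟨ψ, hψ⟩, hne⟩
  rw [← hU] at hmem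
  obtain ⟨φ, hφ, hx'⟩ := Set.mem_iUnion₂.1 hmem
  obtain ⟨n, hn⟩ : φ ∈ Set.range w := hw ▸ Set.mem_insert_of_mem _ hφ
  exact hx' (hn ▸ h n)

/-! ### Characters of the group of null sequences -/

namespace T0H

/-- The element of `𝕋₀ᴴ` with a prescribed finite initial segment and `1` elsewhere. -/
noncomputable def initial (N : ℕ) (z : ℕ → Circle) : T0H :=
  ⟨fun n => if n < N then z n else 1, tendsto_const_nhds.congr'
    ((eventually_ge_atTop N).mono fun _ hn => (if_neg (not_lt.2 hn)).symm)⟩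

theorem coord_initial (N : ℕ) (z : ℕ → Circle) (n : ℕ) :
    coord n (initial N z) = if n < N then z n else 1 := rfl

theorem dist_le_of_forall {v w : T0H} {r : ℝ} (h : ∀ n, dist (coord n v) (coord n w) ≤ r) :
    dist v w ≤ r :=
  ciSup_le h

theorem dist_coord_le (v w : T0H) (n : ℕ) : dist (coord n v) (coord n w) ≤ dist v w :=
  le_ciSup (bddAbove_dist v w) n

/-- The coordinates are characters of `𝕋₀ᴴ`. -/
noncomputable def coordHom (n : ℕ) : T0H →ₜ* Circle where
  toFun := coord n
  map_one' := rfl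
  map_mul' _ _ := rfl
  continuous_toFun := (LipschitzWith.mk_one fun v w => dist_coord_le v w n).continuous

/-- The inclusion of the circle as the `n`-th coordinate of `𝕋₀ᴴ`. -/
noncomputable def single (n : ℕ) : Circle →ₜ* T0H where
  toFun z := initial (n + 1) fun k => if k = n then z else 1
  map_one' := ext_coord fun k => by
    rw [coord_initial]; simp only [ite_self]; rfl
  map_mul' z w := ext_coord fun k => by
    change coord k (initial _ _) = coord k (initial _ _) * coord k (initial _ _)
    simp only [coord_initial]
    split_ifs <;> simp
  continuous_toFun := (LipschitzWith.mk_one fun z w => dist_le_of_forall fun k => by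
    simp only [coord_initial]
    split_ifs <;> simp).continuous

theorem initial_succ (N : ℕ) (z : ℕ → Circle) :
    initial (N + 1) z = initial N z * single N (z N) := ext_coord fun k => by
  change coord k (initial _ _) = coord k (initial _ _) * coord k (initial _ _)
  simp only [coord_initial]
  rcases lt_trichotomy k N with h | rfl | h
  · simp [h, h.ne, h.trans (Nat.lt_succ_self N)]
  · simp
  · simp [h.not_gt, show ¬ k < N + 1 by omega]

/-- Coordinates tend to `1`, so the discarded tail is uniformly close to `1`, as the supremum metric
requires. -/
theorem tendsto_initial (w : T0H) : Tendsto (fun N => initial N fun n => coord n w) atTop (𝓝 w) := by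
  rw [Metric.tendsto_atTop]
  intro ε hε
  obtain ⟨N, hN⟩ := Metric.tendsto_atTop.1 (show Tendsto (fun n => coord n w) atTop (𝓝 1) from w.2)
    (ε / 2) (half_pos hε)
  refine ⟨N, fun M hM => (dist_le_of_forall fun n => ?_).trans_lt (half_lt_self hε)⟩
  rw [coord_initial]
  split_ifs with h
  · rw [dist_self]; exact (half_pos hε).le
  · rw [dist_comm]; exact (hN n (by omega)).le

theorem dist_exp_one_le (t : ℝ) : dist (Circle.exp t) 1 ≤ |t| := by
  change dist (Circle.exp t : ℂ) ((1 : Circle) : ℂ) ≤ |t|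
  rw [Complex.dist_eq, Circle.coe_exp, Circle.coe_one, mul_comm]
  exact Real.norm_exp_I_mul_ofReal_sub_one_le

theorem character_initial (α : PontryaginDual T0H) {m : ℕ → ℤ}
    (hm : ∀ n z, α (single n z) = z ^ m n) (N : ℕ) (z : ℕ → Circle) :
    α (initial N z) = ∏ n ∈ Finset.range N, z n ^ m n := by
  induction N with
  | zero =>
    rw [show initial 0 z = 1 from ext_coord fun k => by rw [coord_initial]; rfl]
    simp
  | succ N ih => rw [initial_succ, map_mul, ih, hm, Finset.prod_range_succ]

/-- Every character of `𝕋₀ᴴ` is a monomial in finitely many coordinates. -/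
theorem exists_character_eq_prod (α : PontryaginDual T0H) :
    ∃ (N : ℕ) (m : ℕ → ℤ), ∀ w, α w = ∏ n ∈ Finset.range N, coord n w ^ m n := by
  choose m hm using fun n => exists_zpow_of_character_circle (PontryaginDual.map (single n) α)
  have hopen : IsOpen (α ⁻¹' {z | z ≠ Circle.exp Real.pi}) :=
    isOpen_ne.preimage (map_continuous α)
  obtain ⟨δ, hδ, hball⟩ := Metric.isOpen_iff.1 hopen 1 (by
    change α 1 ≠ _
    rw [map_one]
    exact Circle.exp_pi_ne_one.symm)
  -- Were the sum `s` larger, the point with coordinates `exp (± π / s)`, signs matching those of `m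
  -- n`, would be within `δ / 2` of `1` and yet be sent to `exp π`.
  have hbound (N : ℕ) : ∑ n ∈ Finset.range N, |(m n : ℝ)| ≤ Real.pi / (δ / 2) := by
    by_contra! hlt
    set s := ∑ n ∈ Finset.range N, |(m n : ℝ)| with hs
    have hspos : 0 < s := lt_trans (by positivity) hlt
    rw [div_lt_iff₀ (half_pos hδ)] at hlt
    let θ := Real.pi / s
    have hθ : 0 < θ := by positivity
    have hθδ : θ < δ / 2 := by rw [div_lt_iff₀ hspos]; linarith
    let z : ℕ → Circle := fun n => Circle.exp (SignType.sign (m n : ℝ) * θ)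
    have hmem : initial N z ∈ Metric.ball (1 : T0H) δ := by
      refine (dist_le_of_forall fun n => ?_).trans_lt (half_lt_self hδ)
      rw [coord_initial, show coord n (1 : T0H) = 1 from rfl]
      split_ifs
      · refine (dist_exp_one_le _).trans (le_trans ?_ hθδ.le)
        rw [abs_mul, abs_of_pos hθ]
        refine mul_le_of_le_one_left hθ.le ?_
        rcases SignType.sign (m n : ℝ) with _ | _ | _ <;> simp
      · rw [dist_self]; exact (half_pos hδ).le
    refine hball hmem ?_
    rw [character_initial α hm]
    have : ∀ n, z n ^ m n = Circle.exp (|(m n : ℝ)| * θ) := fun n => by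
      change (Circle.exp _) ^ m n = _
      rw [← Circle.exp_zsmul, zsmul_eq_mul, ← mul_assoc, self_mul_sign]
    simp only [this]
    have hprod : ∏ n ∈ Finset.range N, Circle.exp (|(m n : ℝ)| * θ) =
        Circle.exp (∑ n ∈ Finset.range N, |(m n : ℝ)| * θ) :=
      (map_sum Circle.expHom (fun n => |(m n : ℝ)| * θ) (Finset.range N)).symm
    rw [hprod, ← Finset.sum_mul, ← hs, mul_div_cancel₀ _ hspos.ne']
  -- A summable sequence of integers is eventually zero.
  have hsum : Summable fun n => |(m n : ℝ)| :=
    summable_of_sum_range_le (fun n => abs_nonneg _) hbound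
  obtain ⟨N, hN⟩ := eventually_atTop.1
    (hsum.tendsto_atTop_zero.eventually (gt_mem_nhds (zero_lt_one (α := ℝ))))
  have hzero : ∀ n, N ≤ n → m n = 0 := fun n hn => by
    have := hN n hn
    rw [← Int.cast_abs] at this
    exact Int.abs_lt_one_iff.1 (by exact_mod_cast this)
  refine ⟨N, m, fun w => tendsto_nhds_unique
    (((map_continuous α).tendsto w).comp (tendsto_initial w)) ?_⟩
  refine tendsto_const_nhds.congr' ((eventually_ge_atTop N).mono fun M hM => ?_)
  rw [Function.comp_apply, character_initial α hm]
  refine Finset.prod_subset (Finset.range_mono hM) fun n _ hn => ?_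
  rw [hzero n (by simpa using hn), zpow_zero]

end T0H

/-! ### The graph criterion for dense subgroups -/

section Graph

variable {X : Type*} [CommGroup X] [TopologicalSpace X]

/-- The graph of `x ↦ (u_n(x))` inside `X × 𝕋₀ᴴ`. -/
def characterGraph (u : ℕ → PontryaginDual X) : Subgroup (X × T0H) where
  carrier := {p | ∀ n, u n p.1 = T0H.coord n p.2}
  one_mem' n := map_one (u n)
  mul_mem' {p q} hp hq n := by
    change u n (p.1 * q.1) = T0H.coord n p.2 * T0H.coord n q.2
    rw [map_mul, hp, hq]
  inv_mem' {p} hp n := by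
    change u n p.1⁻¹ = (T0H.coord n p.2)⁻¹
    rw [map_inv, hp]

/-- The characters `(x, w) ↦ u n x * (coord n w)⁻¹` cut out the graph. -/
theorem duallyClosed_characterGraph (u : ℕ → PontryaginDual X) :
    DuallyClosed (characterGraph u) := by
  intro a ha
  obtain ⟨n, hn⟩ := not_forall.1 ha
  refine ⟨PontryaginDual.map (ContinuousMonoidHom.fst X T0H) (u n) *
    (PontryaginDual.map (ContinuousMonoidHom.snd X T0H) (T0H.coordHom n : PontryaginDual T0H))⁻¹,
    fun p hp => ?_, ?_⟩
  · change u n p.1 * (T0H.coord n p.2)⁻¹ = 1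
    rw [hp n, mul_inv_cancel]
  · change u n a.1 * (T0H.coord n a.2)⁻¹ ≠ 1
    rwa [Ne, mul_inv_eq_one]

theorem bijOn_fst_characterGraph (u : ℕ → PontryaginDual X) :
    Set.BijOn Prod.fst (characterGraph u : Set (X × T0H)) (sSubgroup u : Set X) := by
  refine ⟨fun p hp => ?_, fun p hp q hq h => ?_, fun x hx => ?_⟩
  · change Tendsto (fun n => u n p.1) atTop (𝓝 1)
    rw [show (fun n => u n p.1) = fun n => T0H.coord n p.2 from funext hp]
    exact p.2.2
  · exact Prod.ext h (T0H.ext_coord fun n => by rw [← hp n, ← hq n, h])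
  · exact ⟨(x, ⟨fun n => u n x, hx⟩), fun n => rfl, rfl⟩

/-- A character of `X × 𝕋₀ᴴ` trivial on the graph of `x ↦ (u_n(x))` over a dense set is trivial on
the whole graph. -/
theorem character_eq_one_on_graph (u : ℕ → PontryaginDual X) {D : Set X} (hD : Dense D)
    (χ : PontryaginDual (X × T0H))
    (hχ : ∀ x ∈ D, ∃ w : T0H, (∀ n, u n x = T0H.coord n w) ∧ χ (x, w) = 1)
    {p : X × T0H} (hp : p ∈ characterGraph u) : χ p = 1 := by
  obtain ⟨N, m, hm⟩ := T0H.exists_character_eq_prod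
    (PontryaginDual.map (ContinuousMonoidHom.inr X T0H) χ)
  let β : PontryaginDual X := PontryaginDual.map (ContinuousMonoidHom.inl X T0H) χ
  have hsplit (x : X) (w : T0H) (hw : ∀ n, u n x = T0H.coord n w) :
      χ (x, w) = β x * ∏ n ∈ Finset.range N, u n x ^ m n := by
    simp only [hw]
    rw [← hm]
    change _ = χ (x, 1) * χ (1, w)
    rw [← map_mul, Prod.mk_mul_mk, mul_one, one_mul]
  have hcont : Continuous fun x => β x * ∏ n ∈ Finset.range N, u n x ^ m n :=
    (map_continuous β).mul
      (continuous_finsetProd _ fun n _ => (map_continuous (u n)).zpow (m n))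
  have heq := hcont.ext_on hD (continuous_const (y := (1 : Circle))) fun x hx => by
    obtain ⟨w, hw, h1⟩ := hχ x hx
    exact (hsplit x w hw).symm.trans h1
  exact (hsplit p.1 p.2 hp).trans (congrFun heq p.1)

theorem characterizedBy_iff_exists_duallyClosed {G : Subgroup X} (hG : Dense (G : Set X))
    (u : ℕ → PontryaginDual X) :
    CharacterizedBy G u ↔ ∃ Gu : Subgroup (X × T0H), DuallyClosed Gu ∧
      Set.BijOn (Prod.fst : X × T0H → X) (Gu : Set (X × T0H)) (G : Set X) ∧
      ∀ n : ℕ, ∀ p ∈ Gu, u n p.1 = T0H.coord n p.2 := by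
  constructor
  · rintro rfl
    exact ⟨characterGraph u, duallyClosed_characterGraph u, bijOn_fst_characterGraph u,
      fun n p hp => hp n⟩
  · rintro ⟨Gu, hdual, hbij, hcoord⟩
    suffices h : Gu = characterGraph u by
      rw [h] at hbij
      exact SetLike.coe_injective (hbij.image_eq.symm.trans (bijOn_fst_characterGraph u).image_eq)
    refine le_antisymm (fun p hp n => hcoord n p hp) fun p hp => ?_
    by_contra hpn
    obtain ⟨χ, hχ, hne⟩ := hdual p hpn
    refine hne (character_eq_one_on_graph u hG χ (fun x hx => ?_) hp)
    obtain ⟨q, hq, rfl⟩ := hbij.surjOn hx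
    exact ⟨q.2, fun n => hcoord n q hq, hχ q hq⟩

end Graph

/-! ### Passing between a group and a closed subgroup -/

theorem mem_sSubgroup {X : Type*} [CommGroup X] [TopologicalSpace X]
    {u : ℕ → PontryaginDual X} {x : X} :
    x ∈ sSubgroup u ↔ Tendsto (fun n => u n x) atTop (𝓝 1) := Iff.rfl

/-- The sequence running through `v` at even indices and repeating every `w k` infinitely often at
odd indices. -/
def interleave {A : Type*} (v w : ℕ → A) (n : ℕ) : A :=
  if n % 2 = 0 then v (n / 2) else w (n / 2).unpair.1

theorem interleave_even {A : Type*} (v w : ℕ → A) (n : ℕ) : interleave v w (2 * n) = v n := by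
  simp [interleave]

theorem interleave_odd {A : Type*} (v w : ℕ → A) (k j : ℕ) :
    interleave v w (2 * Nat.pair k j + 1) = w k := by
  have h1 : (2 * Nat.pair k j + 1) % 2 = 1 := by omega
  have h2 : (2 * Nat.pair k j + 1) / 2 = Nat.pair k j := by omega
  simp [interleave, h1, h2]

theorem mem_sSubgroup_interleave {X : Type*} [CommGroup X] [TopologicalSpace X]
    (v w : ℕ → PontryaginDual X) (x : X) :
    x ∈ sSubgroup (interleave v w) ↔ x ∈ sSubgroup v ∧ ∀ n, w n x = 1 := by
  simp only [mem_sSubgroup]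
  constructor
  · refine fun h => ⟨?_, fun k => ?_⟩
    · have := h.comp (tendsto_id.const_mul_atTop' (two_pos : 0 < 2))
      exact this.congr fun n => by simp [interleave_even]
    -- For fixed `k` these odd indices give a subsequence constantly equal to `w k x`, so its limit
    -- `1` is its value.
    · have hodd : Tendsto (fun j => 2 * Nat.pair k j + 1) atTop atTop :=
        tendsto_atTop_mono (fun j => by have := Nat.right_le_pair k j; rw [id]; omega) tendsto_id
      exact tendsto_nhds_unique (tendsto_const_nhds.congr fun j => by
        simp [interleave_odd]) (h.comp hodd)
  · rintro ⟨hv, hw⟩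
    refine tendsto_nhds.2 fun s hs h1 => ?_
    obtain ⟨N, hN⟩ := eventually_atTop.1 (tendsto_nhds.1 hv s hs h1)
    refine mem_atTop_sets.2 ⟨2 * N, fun n hn => ?_⟩
    change interleave v w n x ∈ s
    unfold interleave
    split_ifs
    · exact hN _ (by omega)
    · rwa [hw]

/-- Being characterized passes from a compact metrizable group to a subgroup and, if that subgroup
is closed, back. -/
theorem isCharacterized_iff_subgroupOf {X : Type*} [CommGroup X] [TopologicalSpace X]
    [IsTopologicalGroup X] [CompactSpace X] [T2Space X] [SecondCountableTopology X]
    {G H : Subgroup X} (hH : IsClosed (H : Set X)) (hGH : G ≤ H) :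
    IsCharacterized G ↔ IsCharacterized (G.subgroupOf H) := by
  constructor
  · rintro ⟨u, rfl⟩
    let i : H →ₜ* X := ⟨H.subtype, continuous_subtype_val⟩
    exact ⟨fun n => PontryaginDual.map i (u n), rfl⟩
  · rintro ⟨v, hv⟩
    choose ψ hψ using fun n => exists_character_extension H hH (v n)
    obtain ⟨w, hw⟩ := exists_seq_character_eq_closed H hH
    refine ⟨interleave ψ w, Subgroup.ext fun x => ?_⟩
    rw [mem_sSubgroup_interleave, ← hw]
    have key (hx : x ∈ H) : x ∈ G ↔ x ∈ sSubgroup ψ := by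
      have h1 : x ∈ G ↔ (⟨x, hx⟩ : H) ∈ sSubgroup v := by
        rw [← hv, Subgroup.mem_subgroupOf]
      rw [h1, mem_sSubgroup, mem_sSubgroup]
      simp only [← hψ]
    exact ⟨fun hx => ⟨(key (hGH hx)).1 hx, hGH hx⟩, fun h => (key h.2).2 h.1⟩

theorem theorem1 {X : Type*} [CommGroup X] [TopologicalSpace X] [IsTopologicalGroup X]
    [CompactSpace X] [TopologicalSpace.MetrizableSpace X] [Infinite X] (G : Subgroup X) :
    (Dense (G : Set X) →
      ∀ u : ℕ → PontryaginDual X,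
        CharacterizedBy G u ↔
          ∃ Gu : Subgroup (X × T0H),
            DuallyClosed Gu ∧
            Set.BijOn (Prod.fst : X × T0H → X) (Gu : Set (X × T0H)) (G : Set X) ∧
            ∀ n : ℕ, ∀ p ∈ Gu, u n p.1 = T0H.coord n p.2) ∧
    (IsCharacterized G ↔ IsCharacterized (G.subgroupOf G.topologicalClosure)) := by
  refine ⟨characterizedBy_iff_exists_duallyClosed, ?_⟩
  -- A compact metric space is second countable and Hausdorff, as the closed-subgroup criterion
  -- needs.
  let _ := TopologicalSpace.metrizableSpaceMetric X
  exact isCharacterized_iff_subgroupOf G.isClosed_topologicalClosure G.le_topologicalClosure
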